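/- Let $a<b$ be real numbers and let $\Phi:[a,b]\to\mathbb R$ be strictly increasing and differentiable with $\Phi'(\ell)\neq 0$ for all $\ell\in[a,b]$ (one-sided derivatives at the endpoints). For $\alpha>0$ put $$\mathbb I_{a^+}^{\alpha;\Phi}z(\ell)=\int_a^\ell \frac{\Phi'(\rho)(\Phi(\ell)-\Phi(\rho))^{\alpha-1}}{\Gamma(\alpha)}\,z(\rho)\,d\rho ,$$ and let $\mathbb I_{a^+}^{0;\Phi}$ be the identity. For $0<\mu\le 1$ and $z\in C([a,b],\mathbb R)$ the $\Phi$-Caputo derivative of $z$ is $${}^c\mathbb D_{a^+}^{\mu;\Phi}z(\ell)=\frac1{\Phi'(\ell)}\frac{d}{d\ell}\,\mathbb I_{a^+}^{1-\mu;\Phi}\bigl[z-z(a)\bigr](\ell),$$ provided that the derivative on the right exists (as a one-sided derivative at the endpoints). For $p,q>0$ and $x\in\mathbb R$ let $\mathbb E_{p,q}(x)=\sum_{k=0}^\infty \frac{x^k}{\Gamma(pk+q)}$. Let $0<\kappa<\mu\le 1$, $\omega>0$, $z_a\in\mathbb R$ and $H\in C([a,b],\mathbb R)$. Then the linear problem $${}^c\mathbb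 D_{a^+}^{\mu;\Phi}z(\ell)+\omega\,{}^c\mathbb D_{a^+}^{\kappa;\Phi}z(\ell)=H(\ell)\quad(\ell\in[a,b]),\qquad z(a)=z_a, \tag{1}$$ has exactly one solution in the class of all $z\in C([a,b],\mathbb R)$ for which both Caputo derivatives exist at every point of $[a,b]$, and this solution is $$z(\ell)=z_a+\int_a^\ell \Phi'(\rho)(\Phi(\ell)-\Phi(\rho))^{\mu-1}\,\mathbb E_{\mu-\kappa,\mu}\bigl(-\omega(\Phi(\ell)-\Phi(\rho))^{\mu-\kappa}\bigr)H(\rho)\,d\rho,\qquad \ell\in[a,b], \tag{2}$$ where the integrand is integrable on $[a,\ell]$ for every $\ell\in[a,b]$. Moreover, if $\Phi\in C^1([a,b])$ and $z\in C^1([a,b],\mathbb R)$ satisfies (1) with the Caputo derivatives of order $\nu\in\{\mu,\kappa\}$ taken in the form ${}^c\mathbb D_{a^+}^{\nu;\Phi}z=\mathbb I_{a^+}^{1-\nu;\Phi}\bigl[z'/\Phi'\bigr]$ (which is $z'/\Phi'$ when $\nu=1$), then $z$ is given by (2) as well. -/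

import Mathlib

open Set MeasureTheory

noncomputable section

namespace PhiCaputo

/-- The two-parameter Mittag-Leffler function `E_{p,q}(x) = ∑ x ^ k / Γ(p k + q)`. -/
def mittagLeffler (p q x : ℝ) : ℝ :=
  ∑' k : ℕ, x ^ k / Real.Gamma (p * k + q)

/-- The Riemann-Liouville integral of order `α > 0` of `z` with respect to `Φ`, based at `a`.
The derivative of `Φ : [a, b] → ℝ` is one-sided at the endpoints. -/
def phiIntegral (a b : ℝ) (Φ : ℝ → ℝ) (α : ℝ) (z : ℝ → ℝ) (l : ℝ) : ℝ :=
  ∫ r in a..l, derivWithin Φ (Icc a b) r * (Φ l - Φ r) ^ (α - 1) / Real.Gamma α * z r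

/-- `I^{1-μ;Φ} (z - z(a))` for `0 < μ ≤ 1`, where `I^{0;Φ}` is the identity. -/
def caputoPrimitive (a b : ℝ) (Φ : ℝ → ℝ) (μ : ℝ) (z : ℝ → ℝ) (l : ℝ) : ℝ :=
  if μ = 1 then z l - z a else phiIntegral a b Φ (1 - μ) (fun r => z r - z a) l

/-- The Caputo derivative of order `0 < μ ≤ 1` of a continuous function `z` with respect to `Φ`,
`(1 / Φ') (d / dl) I^{1-μ;Φ} (z - z(a))`. It exists at `l` when `caputoPrimitive a b Φ μ z` is
differentiable at `l` relative to `[a, b]`. -/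
def caputo (a b : ℝ) (Φ : ℝ → ℝ) (μ : ℝ) (z : ℝ → ℝ) (l : ℝ) : ℝ :=
  derivWithin (caputoPrimitive a b Φ μ z) (Icc a b) l / derivWithin Φ (Icc a b) l

/-- The Caputo derivative of order `0 < μ ≤ 1` with respect to `Φ` in its form for continuously
differentiable functions: `I^{1-μ;Φ} (z' / Φ')`, and `z' / Φ'` when `μ = 1`. -/
def caputoC1 (a b : ℝ) (Φ : ℝ → ℝ) (μ : ℝ) (z : ℝ → ℝ) (l : ℝ) : ℝ :=
  if μ = 1 then derivWithin z (Icc a b) l / derivWithin Φ (Icc a b) l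
  else phiIntegral a b Φ (1 - μ)
    (fun r => derivWithin z (Icc a b) r / derivWithin Φ (Icc a b) r) l

/-- `z ∈ C([a, b])` solves `D^μ z + ω D^κ z = H` on `[a, b]`, `z(a) = za`; both Caputo derivatives
exist at every point of `[a, b]`. -/
structure IsSolution (a b : ℝ) (Φ : ℝ → ℝ) (μ κ ω : ℝ) (H : ℝ → ℝ) (za : ℝ) (z : ℝ → ℝ) :
    Prop where
  continuousOn : ContinuousOn z (Icc a b)
  differentiable_mu : DifferentiableOn ℝ (caputoPrimitive a b Φ μ z) (Icc a b)
  differentiable_kappa : DifferentiableOn ℝ (caputoPrimitive a b Φ κ z) (Icc a b)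
  equation : ∀ l ∈ Icc a b, caputo a b Φ μ z l + ω * caputo a b Φ κ z l = H l
  initial : z a = za

/-- `z ∈ C¹([a, b])` solves the same problem, with the Caputo derivatives in the form that they
have for continuously differentiable functions. -/
structure IsC1Solution (a b : ℝ) (Φ : ℝ → ℝ) (μ κ ω : ℝ) (H : ℝ → ℝ) (za : ℝ) (z : ℝ → ℝ) :
    Prop where
  contDiffOn : ContDiffOn ℝ 1 z (Icc a b)
  equation : ∀ l ∈ Icc a b, caputoC1 a b Φ μ z l + ω * caputoC1 a b Φ κ z l = H l
  initial : z a = za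

/-- The integrand of the solution formula. -/
def solutionIntegrand (a b : ℝ) (Φ : ℝ → ℝ) (μ κ ω : ℝ) (H : ℝ → ℝ) (l r : ℝ) : ℝ :=
  derivWithin Φ (Icc a b) r * (Φ l - Φ r) ^ (μ - 1)
    * mittagLeffler (μ - κ) μ (-ω * (Φ l - Φ r) ^ (μ - κ)) * H r

/-- The Mittag-Leffler series converges for all `p, q > 0` and all real `x`. -/
theorem summable_mittagLeffler {p q : ℝ} (hp : 0 < p) (hq : 0 < q) (x : ℝ) :
    Summable fun k : ℕ => x ^ k / Real.Gamma (p * k + q) := by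
  obtain ⟨R, hR0, hR⟩ : ∃ R : ℝ, 0 < R ∧ 2 * |x| + 1 ≤ R ^ p :=
    ⟨(2 * |x| + 1) ^ p⁻¹, by positivity, by
      rw [← Real.rpow_mul (by positivity), inv_mul_cancel₀ hp.ne', Real.rpow_one]⟩
  have key : ∀ s : ℝ, 1 ≤ s → R ^ (s - 1) * Real.exp (-R) ≤ Real.Gamma s := by
    intro s hs
    rw [Real.Gamma_eq_integral (by linarith), ← integral_exp_neg_Ioi R, ← integral_const_mul]
    have hI := Real.GammaIntegral_convergent (s := s) (by linarith)
    have hsub : Ioi R ⊆ Ioi (0 : ℝ) := Ioi_subset_Ioi hR0.le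
    calc ∫ t in Ioi R, R ^ (s - 1) * Real.exp (-t)
        ≤ ∫ t in Ioi R, Real.exp (-t) * t ^ (s - 1) := by
          refine setIntegral_mono_on ?_ (hI.mono_set hsub) measurableSet_Ioi ?_
          · exact (integrableOn_exp_neg_Ioi R).const_mul _
          · intro t ht
            rw [mul_comm]
            have : R ^ (s - 1) ≤ t ^ (s - 1) :=
              Real.rpow_le_rpow hR0.le (le_of_lt ht) (by linarith)
            gcongr
      _ ≤ ∫ t in Ioi (0 : ℝ), Real.exp (-t) * t ^ (s - 1) := by
          refine setIntegral_mono_set hI ?_ hsub.eventuallyLE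
          filter_upwards [ae_restrict_mem measurableSet_Ioi] with t ht
          have : (0 : ℝ) < t := ht
          positivity
  have hg : Summable fun k : ℕ => (Real.exp R * R ^ (1 - q)) * (1 / 2 : ℝ) ^ k :=
    (summable_geometric_of_lt_one (by norm_num) (by norm_num)).mul_left _
  refine Summable.of_norm_bounded_eventually_nat hg ?_
  obtain ⟨N, hN⟩ := exists_nat_ge (1 / p)
  filter_upwards [Filter.eventually_ge_atTop N] with k hk
  have h1 : 1 ≤ p * k + q := by
    have : 1 / p ≤ (k : ℝ) := hN.trans (by exact_mod_cast hk)
    rw [div_le_iff₀ hp] at this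
    nlinarith
  have h2 := key _ h1
  have hG : 0 < Real.Gamma (p * k + q) := Real.Gamma_pos_of_pos (by linarith)
  rw [norm_div, norm_pow, Real.norm_eq_abs, Real.norm_eq_abs, abs_of_pos hG, div_le_iff₀ hG]
  have h3 : R ^ (p * k + q - 1) = (R ^ p) ^ k * R ^ (q - 1) := by
    rw [← Real.rpow_natCast (R ^ p), ← Real.rpow_mul hR0.le, ← Real.rpow_add hR0]
    congr 1; ring
  have h4 : R ^ (1 - q) * R ^ (q - 1) = 1 := by
    rw [← Real.rpow_add hR0]; simp
  have h5 : Real.exp R * Real.exp (-R) = 1 := by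
    rw [← Real.exp_add]; simp
  have h6 : |x| ^ k ≤ (1 / 2 : ℝ) ^ k * (R ^ p) ^ k := by
    rw [← mul_pow]
    exact pow_le_pow_left₀ (abs_nonneg x) (by linarith) k
  calc |x| ^ k ≤ (1 / 2 : ℝ) ^ k * (R ^ p) ^ k := h6
    _ = Real.exp R * R ^ (1 - q) * (1 / 2) ^ k * (R ^ (p * k + q - 1) * Real.exp (-R)) := by
        rw [h3]
        linear_combination (-(1 / 2 : ℝ) ^ k * (R ^ p) ^ k * (R ^ (1 - q) * R ^ (q - 1))) * h5
          - (1 / 2 : ℝ) ^ k * (R ^ p) ^ k * h4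
    _ ≤ _ := by gcongr

end PhiCaputo

end

/-! The substitution `s = Φ r - Φ a` turns the `Φ`-integrals into ordinary Riemann-Liouville
integrals `I^α` based at `0`; write `h` for `H` and `u` for `z - z(a)` in the new variable.
Integrating the equation once gives `I^{1-μ} u + ω I^{1-κ} u = I^1 h`. Applying `I^μ`, using the
semigroup law `I^α I^β = I^{α+β}` (`rl_rl`) and cancelling `I^1` by differentiation leaves the
Volterra equation `u + ω I^δ u = I^μ h` with `δ = μ - κ > 0`.

The factor `1 / Γ(kδ + 1)` in the bound for `I^{kδ}` makes the Neumann series `v = ∑ (-ω)^k I^{kδ}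
h` converge locally uniformly. It solves `v + ω I^δ v = h` (`resolvent_eq`), and the same bound
forces uniqueness (`eq_zero_of_volterra`), so `u = I^μ v`. Summing the kernels of `I^{kδ+μ}`
produces the Mittag-Leffler kernel (`integral_mittagLeffler_eq_rl_resolvent`).

Conversely, for `u = I^μ v` one has `I^{1-ν} u = I^1 I^{μ-ν} v`, so the Caputo derivatives of orders
`μ` and `κ` exist and equal `v` and `I^δ v`. -/

open Set MeasureTheory

noncomputable section

namespace PhiCaputo

/-! ### Riemann-Liouville integrals on the half-line -/

/-- The Riemann-Liouville integral of order `α` based at `0`; it is the identity for `α = 0`. -/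
def rl (α : ℝ) (f : ℝ → ℝ) (x : ℝ) : ℝ :=
  if α = 0 then f x else ∫ s in (0 : ℝ)..x, (x - s) ^ (α - 1) / Real.Gamma α * f s

@[simp] theorem rl_zero (f : ℝ → ℝ) (x : ℝ) : rl 0 f x = f x := by simp [rl]

theorem rl_of_pos {α : ℝ} (hα : 0 < α) (f : ℝ → ℝ) (x : ℝ) :
    rl α f x = ∫ s in (0 : ℝ)..x, (x - s) ^ (α - 1) / Real.Gamma α * f s := by
  rw [rl, if_neg hα.ne']

theorem rl_one (f : ℝ → ℝ) (x : ℝ) : rl 1 f x = ∫ s in (0 : ℝ)..x, f s := by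
  simp [rl]

theorem rl_apply_zero {α : ℝ} (hα : 0 < α) (f : ℝ → ℝ) : rl α f 0 = 0 := by
  simp [rl_of_pos hα]

theorem rl_congr {α x : ℝ} (hx : 0 ≤ x) {f g : ℝ → ℝ} (h : ∀ s ∈ Icc 0 x, f s = g s) :
    rl α f x = rl α g x := by
  unfold rl
  split_ifs
  · exact h x ⟨hx, le_rfl⟩
  · refine intervalIntegral.integral_congr fun s hs => ?_
    rw [uIcc_of_le hx] at hs
    simp only [h s hs]

theorem rl_const_mul (α c : ℝ) (f : ℝ → ℝ) (x : ℝ) :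
    rl α (fun s => c * f s) x = c * rl α f x := by
  unfold rl
  split_ifs
  · rfl
  · rw [← intervalIntegral.integral_const_mul]
    congr 1; ext s; ring

theorem intervalIntegrable_kernel {α : ℝ} (hα : 0 < α) (x : ℝ) :
    IntervalIntegrable (fun s => (x - s) ^ (α - 1)) volume 0 x := by
  have := (intervalIntegral.intervalIntegrable_rpow' (r := α - 1) (by linarith)
    (a := x) (b := 0)).comp_sub_left x
  simpa using this

theorem intervalIntegrable_kernel_mul {α : ℝ} (hα : 0 < α) {x : ℝ} (hx : 0 ≤ x) {f : ℝ → ℝ}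
    (hf : ContinuousOn f (Icc 0 x)) :
    IntervalIntegrable (fun s => (x - s) ^ (α - 1) / Real.Gamma α * f s) volume 0 x :=
  ((intervalIntegrable_kernel hα x).div_const _).mul_continuousOn (by rwa [uIcc_of_le hx])

theorem rl_add {α : ℝ} (hα : 0 ≤ α) {x : ℝ} (hx : 0 ≤ x) {f g : ℝ → ℝ}
    (hf : ContinuousOn f (Icc 0 x)) (hg : ContinuousOn g (Icc 0 x)) :
    rl α (fun s => f s + g s) x = rl α f x + rl α g x := by
  rcases hα.eq_or_lt with rfl | hα
  · simp
  · rw [rl_of_pos hα, rl_of_pos hα, rl_of_pos hα, ← intervalIntegral.integral_add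
      (intervalIntegrable_kernel_mul hα hx hf) (intervalIntegrable_kernel_mul hα hx hg)]
    congr 1; ext s; ring

theorem integral_kernel {α : ℝ} (hα : 0 < α) (x : ℝ) :
    ∫ s in (0 : ℝ)..x, (x - s) ^ (α - 1) = x ^ α / α := by
  have := intervalIntegral.integral_comp_sub_left (a := 0) (b := x) (fun s => s ^ (α - 1)) x
  rw [this, integral_rpow (Or.inl (by linarith))]
  simp [hα.ne']

theorem abs_rl_le {α : ℝ} (hα : 0 ≤ α) {x M : ℝ} (hx : 0 ≤ x) {f : ℝ → ℝ}
    (hM : ∀ s ∈ Icc 0 x, |f s| ≤ M) :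
    |rl α f x| ≤ M * (x ^ α / Real.Gamma (α + 1)) := by
  rcases hα.eq_or_lt with rfl | hα
  · simpa using hM x ⟨hx, le_rfl⟩
  · have hG := Real.Gamma_pos_of_pos hα
    rw [rl_of_pos hα, ← Real.norm_eq_abs]
    calc _ ≤ ∫ s in (0 : ℝ)..x, (x - s) ^ (α - 1) / Real.Gamma α * M := by
          refine intervalIntegral.norm_integral_le_of_norm_le hx
            (Filter.Eventually.of_forall fun s hs => ?_)
            (((intervalIntegrable_kernel hα x).div_const _).mul_const _)
          have h0 : 0 ≤ (x - s) ^ (α - 1) := Real.rpow_nonneg (by linarith [hs.2]) _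
          rw [norm_mul, Real.norm_of_nonneg (by positivity)]
          exact mul_le_mul_of_nonneg_left (hM s ⟨hs.1.le, hs.2⟩) (by positivity)
      _ = _ := by
          rw [intervalIntegral.integral_mul_const, intervalIntegral.integral_div,
            integral_kernel hα, Real.Gamma_add_one hα.ne']
          field_simp

/-- Rescaling to `[0, 1]` takes `x` out of both the limits and the singular kernel, so that
continuity in `x` follows by dominated convergence. -/
theorem rl_eq_rpow_mul {α : ℝ} (hα : 0 < α) {x : ℝ} (hx : 0 ≤ x) (f : ℝ → ℝ) :
    rl α f x = x ^ α * ∫ s in (0 : ℝ)..1, (1 - s) ^ (α - 1) / Real.Gamma α * f (x * s) := by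
  rcases hx.eq_or_lt with rfl | hx
  · simp [rl_of_pos hα, Real.zero_rpow hα.ne']
  · have := intervalIntegral.mul_integral_comp_mul_left (a := 0) (b := 1) (c := x)
      (f := fun s => (x - s) ^ (α - 1) / Real.Gamma α * f s)
    rw [mul_zero, mul_one] at this
    have hxa : x ^ α = x * x ^ (α - 1) := by
      rw [Real.rpow_sub_one hx.ne']; field_simp
    rw [rl_of_pos hα, ← this, hxa, mul_assoc, ← intervalIntegral.integral_const_mul (x ^ (α - 1))]
    congr 1
    refine intervalIntegral.integral_congr fun s hs => ?_
    rw [uIcc_of_le zero_le_one] at hs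
    have : x - x * s = x * (1 - s) := by ring
    simp only [this, Real.mul_rpow hx.le (sub_nonneg.2 hs.2)]
    ring

theorem continuousOn_rl {α : ℝ} (hα : 0 ≤ α) {f : ℝ → ℝ} (hf : ContinuousOn f (Ici 0)) :
    ContinuousOn (rl α f) (Ici 0) := by
  rcases hα.eq_or_lt with rfl | hα
  · exact hf.congr fun x _ => rl_zero f x
  have key : Continuous fun x : ℝ =>
      ∫ s in (0 : ℝ)..1, (1 - s) ^ (α - 1) / Real.Gamma α * f (max (x * s) 0) := by
    -- Clamping at `0` extends `f` continuously to all of `ℝ` without changing any integral over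
    -- `[0, x]`.
    have hg : Continuous fun y : ℝ => f (max y 0) :=
      hf.comp_continuous (by fun_prop) fun y => mem_Ici.2 (le_max_right _ _)
    have hK := (intervalIntegrable_kernel hα 1).div_const (Real.Gamma α)
    refine continuous_iff_continuousAt.2 fun x₀ => ?_
    obtain ⟨M, hM⟩ := (isCompact_Icc (a := -(|x₀| + 1)) (b := |x₀| + 1)).exists_bound_of_continuousOn
      hg.continuousOn
    refine intervalIntegral.continuousAt_of_dominated_interval
      (bound := fun s => |(1 - s) ^ (α - 1) / Real.Gamma α| * M) ?_ ?_ (hK.abs.mul_const M) ?_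
    · refine Filter.Eventually.of_forall fun x => ?_
      exact (hK.mul_continuousOn (hg.comp (continuous_const_mul x)).continuousOn).def'.aestronglyMeasurable
    · filter_upwards [Metric.ball_mem_nhds x₀ one_pos] with x hx
      refine Filter.Eventually.of_forall fun s hs => ?_
      rw [uIoc_of_le zero_le_one] at hs
      rw [norm_mul, Real.norm_eq_abs]
      refine mul_le_mul_of_nonneg_left (hM _ ?_) (abs_nonneg _)
      rw [Metric.mem_ball, Real.dist_eq] at hx
      have h1 : |x| ≤ |x₀| + 1 := by
        have := abs_sub_abs_le_abs_sub x x₀; linarith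
      have h2 : |x * s| ≤ |x₀| + 1 := by
        rw [abs_mul, abs_of_pos hs.1]
        nlinarith [abs_nonneg x, hs.2, hs.1]
      exact abs_le.1 h2
    · exact Filter.Eventually.of_forall fun s _ =>
      (continuous_const.mul (hg.comp (continuous_mul_const s))).continuousAt
  refine ((Real.continuous_rpow_const hα.le).mul key).continuousOn.congr fun x hx => ?_
  rw [rl_eq_rpow_mul hα hx]
  congr 1
  refine intervalIntegral.integral_congr fun s hs => ?_
  rw [uIcc_of_le zero_le_one] at hs
  simp only [max_eq_left (mul_nonneg hx hs.1)]

theorem hasDerivWithinAt_rl_one {f : ℝ → ℝ} (hf : ContinuousOn f (Ici 0)) {x : ℝ} (hx : 0 ≤ x) :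
    HasDerivWithinAt (rl 1 f) (f x) (Ici 0) x := by
  have hg : Continuous fun y : ℝ => f (max y 0) :=
    hf.comp_continuous (by fun_prop) fun y => mem_Ici.2 (le_max_right _ _)
  have h : HasDerivAt (fun y => ∫ s in (0 : ℝ)..y, f (max s 0)) (f (max x 0)) x :=
    (hg.integral_hasStrictDerivAt 0 x).hasDerivAt
  rw [max_eq_left hx] at h
  have hEq : ∀ y ∈ Ici (0 : ℝ), rl 1 f y = ∫ s in (0 : ℝ)..y, f (max s 0) := by
    intro y hy
    rw [rl_one]
    refine intervalIntegral.integral_congr fun s hs => ?_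
    rw [uIcc_of_le hy] at hs
    simp only [max_eq_left hs.1]
  exact h.hasDerivWithinAt.congr hEq (hEq x hx)

theorem rl_one_cancel {f g : ℝ → ℝ} (hf : ContinuousOn f (Ici 0)) (hg : ContinuousOn g (Ici 0))
    {T : ℝ} (hT : 0 < T) (h : ∀ x ∈ Icc 0 T, rl 1 f x = rl 1 g x) :
    ∀ x ∈ Icc 0 T, f x = g x := by
  intro x hx
  have h1 := (hasDerivWithinAt_rl_one hf hx.1).mono (Icc_subset_Ici_self : Icc 0 T ⊆ Ici 0)
  have h2 := (hasDerivWithinAt_rl_one hg hx.1).mono (Icc_subset_Ici_self : Icc 0 T ⊆ Ici 0)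
  exact (uniqueDiffOn_Icc hT x hx).eq_deriv _ h1 (h2.congr h (h x hx))

/-! ### The Beta integral and the semigroup law -/

theorem integral_beta_kernel {α β : ℝ} (hα : 0 < α) (hβ : 0 < β) {t x : ℝ} (htx : t < x) :
    ∫ s in t..x, (x - s) ^ (α - 1) * (s - t) ^ (β - 1)
      = (x - t) ^ (α + β - 1) * ProbabilityTheory.beta α β := by
  have hsub := intervalIntegral.integral_comp_sub_right (a := t) (b := x)
    (fun y => (x - t - y) ^ (α - 1) * y ^ (β - 1)) t
  have e : ∀ s : ℝ, x - t - (s - t) = x - s := fun s => by ring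
  simp only [e, sub_self] at hsub
  rw [hsub]
  have ha : 0 < x - t := sub_pos.2 htx
  have hC := Complex.betaIntegral_scaled (β : ℂ) (α : ℂ) ha
  have hL : (∫ y in (0 : ℝ)..(x - t), (y : ℂ) ^ ((β : ℂ) - 1)
      * (((x - t : ℝ) : ℂ) - y) ^ ((α : ℂ) - 1))
      = ((∫ y in (0 : ℝ)..(x - t), (x - t - y) ^ (α - 1) * y ^ (β - 1) : ℝ) : ℂ) := by
    rw [← intervalIntegral.integral_ofReal]
    refine intervalIntegral.integral_congr fun y hy => ?_
    rw [uIcc_of_le ha.le] at hy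
    rw [Complex.ofReal_mul, Complex.ofReal_cpow (sub_nonneg.2 hy.2), Complex.ofReal_cpow hy.1,
      mul_comm]
    push_cast; rfl
  have hR := congrArg Complex.re hC
  rw [hL, Complex.ofReal_re, show (β : ℂ) + α - 1 = ((α + β - 1 : ℝ) : ℂ) by push_cast; ring,
    ← Complex.ofReal_cpow ha.le, Complex.re_ofReal_mul, Complex.betaIntegral_symm,
    ← ProbabilityTheory.beta_eq_betaIntegralReal α β hα hβ] at hR
  exact hR

/-- A non-integrable function has integral `0` by convention, whereas the Beta value is positive. -/
theorem intervalIntegrable_beta_kernel {α β : ℝ} (hα : 0 < α) (hβ : 0 < β) {t x : ℝ}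
    (htx : t < x) :
    IntervalIntegrable (fun s => (x - s) ^ (α - 1) * (s - t) ^ (β - 1)) volume t x := by
  apply intervalIntegral.intervalIntegrable_of_integral_ne_zero
  rw [integral_beta_kernel hα hβ htx]
  exact (mul_pos (Real.rpow_pos_of_pos (sub_pos.2 htx) _)
    (ProbabilityTheory.beta_pos hα hβ)).ne'

/-- Fubini on the triangle `0 < t < s < x`: integrating over `s` first leaves a Beta integral. The
same computation with `|g|` gives integrability on the product. -/
theorem integral_kernel_kernel {α β : ℝ} (hα : 0 < α) (hβ : 0 < β) {g : ℝ → ℝ}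
    (hg : Continuous g) {x : ℝ} (hx : 0 ≤ x) :
    ∫ s in (0 : ℝ)..x, (x - s) ^ (α - 1) * ∫ t in (0 : ℝ)..s, (s - t) ^ (β - 1) * g t
      = ProbabilityTheory.beta α β * ∫ t in (0 : ℝ)..x, (x - t) ^ (α + β - 1) * g t := by
  set S : Set (ℝ × ℝ) := {p | 0 < p.2 ∧ p.2 < p.1 ∧ p.1 < x} with hS
  have hSm : MeasurableSet S := by
    refine MeasurableSet.inter (measurableSet_lt measurable_const measurable_snd)
      (MeasurableSet.inter (measurableSet_lt measurable_snd measurable_fst)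
        (measurableSet_lt measurable_fst measurable_const))
  set F : ℝ × ℝ → ℝ := S.indicator
    fun p => (x - p.1) ^ (α - 1) * (p.1 - p.2) ^ (β - 1) * g p.2 with hF
  have hFm : Measurable F := by
    have := hg.measurable
    exact Measurable.indicator (by fun_prop) hSm
  have hF1 : ∀ t, (fun s => F (s, t)) = (Ioo 0 x).indicator (fun t => (Ioo t x).indicator
      fun s => (x - s) ^ (α - 1) * (s - t) ^ (β - 1) * g t) t := by
    intro t; ext s
    by_cases ht : t ∈ Ioo 0 x
    · rw [indicator_of_mem ht]
      by_cases hs : s ∈ Ioo t x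
      · rw [indicator_of_mem hs, hF, indicator_of_mem (show (s, t) ∈ S from ⟨ht.1, hs.1, hs.2⟩)]
      · rw [indicator_of_notMem hs, hF, indicator_of_notMem]
        exact fun h => hs ⟨h.2.1, h.2.2⟩
    · rw [indicator_of_notMem ht, hF, indicator_of_notMem]
      · rfl
      · exact fun h => ht ⟨h.1, h.2.1.trans h.2.2⟩
  have hF2 : ∀ s, (fun t => F (s, t)) = (Ioo 0 x).indicator (fun s => (Ioo 0 s).indicator
      fun t => (x - s) ^ (α - 1) * ((s - t) ^ (β - 1) * g t)) s := by
    intro s; ext t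
    by_cases hs : s ∈ Ioo 0 x
    · rw [indicator_of_mem hs]
      by_cases ht : t ∈ Ioo 0 s
      · rw [indicator_of_mem ht, hF, indicator_of_mem (show (s, t) ∈ S from ⟨ht.1, ht.2, hs.2⟩)]
        simp only [mul_assoc]
      · rw [indicator_of_notMem ht, hF, indicator_of_notMem]
        exact fun h => ht ⟨h.1, h.2.1⟩
    · rw [indicator_of_notMem hs, hF, indicator_of_notMem]
      · rfl
      · exact fun h => hs ⟨h.1.trans h.2.1, h.2.2⟩
  have hI1 : ∀ t, (∫ s, F (s, t)) = (Ioo 0 x).indicator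
      (fun t => ProbabilityTheory.beta α β * ((x - t) ^ (α + β - 1) * g t)) t := by
    intro t
    rw [hF1]
    by_cases ht : t ∈ Ioo 0 x
    · rw [indicator_of_mem ht, indicator_of_mem ht, integral_indicator measurableSet_Ioo,
        ← integral_Ioc_eq_integral_Ioo, ← intervalIntegral.integral_of_le ht.2.le,
        intervalIntegral.integral_mul_const, integral_beta_kernel hα hβ ht.2]
      ring
    · rw [indicator_of_notMem ht, indicator_of_notMem ht]; simp
  have hN1 : ∀ t, (∫ s, ‖F (s, t)‖) = (Ioo 0 x).indicator
      (fun t => ProbabilityTheory.beta α β * ((x - t) ^ (α + β - 1) * |g t|)) t := by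
    intro t
    have : (fun s => ‖F (s, t)‖) = (Ioo 0 x).indicator (fun t => (Ioo t x).indicator
      fun s => (x - s) ^ (α - 1) * (s - t) ^ (β - 1) * |g t|) t := by
      ext s
      rw [congrFun (hF1 t) s]
      by_cases ht : t ∈ Ioo 0 x
      · rw [indicator_of_mem ht, indicator_of_mem ht]
        by_cases hs : s ∈ Ioo t x
        · have h1 : 0 ≤ (x - s) ^ (α - 1) := Real.rpow_nonneg (by linarith [hs.2]) _
          have h2 : 0 ≤ (s - t) ^ (β - 1) := Real.rpow_nonneg (by linarith [hs.1]) _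
          rw [indicator_of_mem hs, indicator_of_mem hs, norm_mul, Real.norm_of_nonneg
            (by positivity), Real.norm_eq_abs]
        · rw [indicator_of_notMem hs, indicator_of_notMem hs, norm_zero]
      · rw [indicator_of_notMem ht, indicator_of_notMem ht]; simp
    rw [this]
    by_cases ht : t ∈ Ioo 0 x
    · rw [indicator_of_mem ht, indicator_of_mem ht, integral_indicator measurableSet_Ioo,
        ← integral_Ioc_eq_integral_Ioo, ← intervalIntegral.integral_of_le ht.2.le,
        intervalIntegral.integral_mul_const, integral_beta_kernel hα hβ ht.2]
      ring
    · rw [indicator_of_notMem ht, indicator_of_notMem ht]; simp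
  have hI2 : ∀ s, (∫ t, F (s, t)) = (Ioo 0 x).indicator
      (fun s => (x - s) ^ (α - 1) * ∫ t in (0 : ℝ)..s, (s - t) ^ (β - 1) * g t) s := by
    intro s
    rw [hF2]
    by_cases hs : s ∈ Ioo 0 x
    · rw [indicator_of_mem hs, indicator_of_mem hs, integral_indicator measurableSet_Ioo,
        ← integral_Ioc_eq_integral_Ioo, ← intervalIntegral.integral_of_le hs.1.le,
        intervalIntegral.integral_const_mul]
    · rw [indicator_of_notMem hs, indicator_of_notMem hs]; simp
  have hint : Integrable F ((volume : Measure ℝ).prod volume) := by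
    refine (integrable_prod_iff' hFm.aestronglyMeasurable).2 ⟨?_, ?_⟩
    · refine Filter.Eventually.of_forall fun t => ?_
      rw [hF1]
      by_cases ht : t ∈ Ioo 0 x
      · rw [indicator_of_mem ht, integrable_indicator_iff measurableSet_Ioo]
        exact (((intervalIntegrable_beta_kernel hα hβ ht.2).mul_const _).1).mono_set
          Ioo_subset_Ioc_self
      · rw [indicator_of_notMem ht]; exact integrable_zero _ _ _
    · simp_rw [hN1]
      have : IntervalIntegrable (fun t => ProbabilityTheory.beta α β *
          ((x - t) ^ (α + β - 1) * |g t|)) volume 0 x :=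
        ((intervalIntegrable_kernel (add_pos hα hβ) x).mul_continuousOn
          hg.abs.continuousOn).const_mul _
      exact (integrable_indicator_iff measurableSet_Ioo).2
        (this.1.mono_set Ioo_subset_Ioc_self)
  have hswap := integral_integral_swap (f := fun s t => F (s, t)) hint
  simp_rw [hI1, hI2] at hswap
  rw [integral_indicator measurableSet_Ioo, integral_indicator measurableSet_Ioo,
    ← integral_Ioc_eq_integral_Ioo, ← integral_Ioc_eq_integral_Ioo,
    ← intervalIntegral.integral_of_le hx, ← intervalIntegral.integral_of_le hx,
    intervalIntegral.integral_const_mul] at hswap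
  exact hswap

/-- The Gamma factors of the two kernels cancel against `B(α, β) = Γ(α) Γ(β) / Γ(α + β)`. -/
theorem rl_rl {α β : ℝ} (hα : 0 ≤ α) (hβ : 0 ≤ β) {f : ℝ → ℝ} (hf : ContinuousOn f (Ici 0))
    {x : ℝ} (hx : 0 ≤ x) : rl α (rl β f) x = rl (α + β) f x := by
  rcases hα.eq_or_lt with rfl | hα
  · simp
  rcases hβ.eq_or_lt with rfl | hβ
  · rw [add_zero]; exact rl_congr hx fun s _ => rl_zero f s
  have hg : Continuous fun y : ℝ => f (max y 0) :=
    hf.comp_continuous (by fun_prop) fun y => mem_Ici.2 (le_max_right _ _)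
  have hfg : ∀ y, 0 ≤ y → ∀ s ∈ Icc 0 y, f s = (fun y : ℝ => f (max y 0)) s :=
    fun y _ s hs => by simp only [max_eq_left hs.1]
  rw [rl_congr (α := α + β) hx (hfg x hx),
    rl_congr hx fun s hs => rl_congr (α := β) hs.1 (hfg s hs.1)]
  have hkk := integral_kernel_kernel hα hβ hg hx
  have hGa := (Real.Gamma_pos_of_pos hα).ne'
  have hGb := (Real.Gamma_pos_of_pos hβ).ne'
  have hGab := (Real.Gamma_pos_of_pos (add_pos hα hβ)).ne'
  have pull : ∀ {γ : ℝ}, 0 < γ → ∀ (h : ℝ → ℝ) (y : ℝ), rl γ h y =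
      (Real.Gamma γ)⁻¹ * ∫ s in (0 : ℝ)..y, (y - s) ^ (γ - 1) * h s := by
    intro γ hγ h y
    rw [rl_of_pos hγ, ← intervalIntegral.integral_const_mul]
    congr 1; ext s; ring
  rw [rl_congr hx fun s _ => pull hβ _ s, rl_const_mul, pull hα, pull (add_pos hα hβ), hkk,
    ProbabilityTheory.beta]
  field_simp

/-! ### Termwise integration and the Neumann series -/

theorem hasSum_integral_mul_of_bound {g : ℝ → ℝ} {x : ℝ} (hx : 0 ≤ x)
    (hg : IntervalIntegrable g volume 0 x) {f : ℕ → ℝ → ℝ}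
    (hf : ∀ k, ContinuousOn (f k) (Icc 0 x)) {b : ℕ → ℝ} (hb : Summable b)
    (hfb : ∀ k, ∀ s ∈ Icc 0 x, |f k s| ≤ b k) :
    HasSum (fun k => ∫ s in (0 : ℝ)..x, g s * f k s)
      (∫ s in (0 : ℝ)..x, g s * ∑' k, f k s) := by
  have hmem : ∀ s ∈ uIoc 0 x, s ∈ Icc 0 x := fun s hs => by
    rw [uIoc_of_le hx] at hs; exact Ioc_subset_Icc_self hs
  refine intervalIntegral.hasSum_integral_of_dominated_convergence (fun k s => |g s| * b k)
    (fun k => ?_) (fun k => ?_) ?_ ?_ ?_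
  · exact (hg.mul_continuousOn (by rw [uIcc_of_le hx]; exact hf k)).def'.aestronglyMeasurable
  · refine Filter.Eventually.of_forall fun s hs => ?_
    rw [norm_mul, Real.norm_eq_abs, Real.norm_eq_abs]
    exact mul_le_mul_of_nonneg_left (hfb k s (hmem s hs)) (abs_nonneg _)
  · exact Filter.Eventually.of_forall fun s _ => hb.mul_left _
  · have : IntervalIntegrable (fun s => |g s| * ∑' k, b k) volume 0 x := hg.abs.mul_const _
    simpa only [tsum_mul_left] using this
  · refine Filter.Eventually.of_forall fun s hs => ?_
    have hsum : Summable fun k => f k s :=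
      Summable.of_norm_bounded hb fun k => hfb k s (hmem s hs)
    exact hsum.hasSum.mul_left (g s)

theorem hasSum_rl {α x : ℝ} (hα : 0 ≤ α) (hx : 0 ≤ x) {f : ℕ → ℝ → ℝ}
    (hf : ∀ k, ContinuousOn (f k) (Icc 0 x)) {b : ℕ → ℝ} (hb : Summable b)
    (hfb : ∀ k, ∀ s ∈ Icc 0 x, |f k s| ≤ b k) :
    HasSum (fun k => rl α (f k) x) (rl α (fun s => ∑' k, f k s) x) := by
  rcases hα.eq_or_lt with rfl | hα
  · simp_rw [rl_zero]
    have hsum : Summable fun k => f k x :=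
      Summable.of_norm_bounded hb fun k => hfb k x ⟨hx, le_rfl⟩
    exact hsum.hasSum
  · simp_rw [rl_of_pos hα]
    exact hasSum_integral_mul_of_bound hx ((intervalIntegrable_kernel hα x).div_const _) hf hb hfb

/-- The Neumann series for the equation `v + ω I^δ v = h`. -/
def resolvent (δ ω : ℝ) (h : ℝ → ℝ) (x : ℝ) : ℝ :=
  ∑' k : ℕ, (-ω) ^ k * rl (k * δ) h x

/-- The bound does not depend on `x ∈ [0, X]` and is a multiple of the `k`-th term of `E_{δ,1}(|ω|
X^δ)`, hence summable when `δ > 0`. -/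
theorem abs_pow_mul_rl_le {δ ω : ℝ} (hδ : 0 ≤ δ) {h : ℝ → ℝ} {X M : ℝ}
    (hM : ∀ s ∈ Icc 0 X, |h s| ≤ M) (k : ℕ) {x : ℝ} (hx : x ∈ Icc 0 X) :
    |(-ω) ^ k * rl (k * δ) h x| ≤ M * ((|ω| * X ^ δ) ^ k / Real.Gamma (δ * k + 1)) := by
  have hX : 0 ≤ X := hx.1.trans hx.2
  have hM0 : 0 ≤ M := (abs_nonneg _).trans (hM 0 ⟨le_rfl, hX⟩)
  have hkδ : 0 ≤ (k : ℝ) * δ := by positivity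
  have hG : 0 < Real.Gamma (δ * k + 1) := Real.Gamma_pos_of_pos (by positivity)
  have h1 := abs_rl_le hkδ hx.1 (f := h) (M := M) fun s hs => hM s ⟨hs.1, hs.2.trans hx.2⟩
  have h2 : x ^ ((k : ℝ) * δ) ≤ (X ^ δ) ^ k := by
    rw [← Real.rpow_natCast, ← Real.rpow_mul hX, mul_comm δ]
    exact Real.rpow_le_rpow hx.1 hx.2 hkδ
  rw [abs_mul, abs_pow, abs_neg, mul_pow]
  calc |ω| ^ k * |rl (k * δ) h x|
      ≤ |ω| ^ k * (M * (x ^ ((k : ℝ) * δ) / Real.Gamma (k * δ + 1))) := by gcongr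
    _ ≤ |ω| ^ k * (M * ((X ^ δ) ^ k / Real.Gamma (δ * k + 1))) := by
        rw [mul_comm (k : ℝ) δ] at h2 ⊢
        gcongr
    _ = _ := by ring

theorem exists_abs_le {h : ℝ → ℝ} (hh : ContinuousOn h (Ici 0)) (X : ℝ) :
    ∃ M, ∀ s ∈ Icc 0 X, |h s| ≤ M :=
  (isCompact_Icc (a := 0) (b := X)).exists_bound_of_continuousOn (hh.mono Icc_subset_Ici_self)

theorem exists_summable_bound {δ : ℝ} (hδ : 0 < δ) (ω : ℝ) {h : ℝ → ℝ}
    (hh : ContinuousOn h (Ici 0)) (X : ℝ) :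
    ∃ b : ℕ → ℝ, Summable b ∧ ∀ k : ℕ, ∀ x ∈ Icc 0 X, |(-ω) ^ k * rl (k * δ) h x| ≤ b k := by
  obtain ⟨M, hM⟩ := exists_abs_le hh X
  exact ⟨_, (summable_mittagLeffler hδ one_pos (|ω| * X ^ δ)).mul_left M,
    fun k x hx => abs_pow_mul_rl_le hδ.le hM k hx⟩

theorem continuousOn_pow_mul_rl {δ : ℝ} (hδ : 0 ≤ δ) (ω : ℝ) {h : ℝ → ℝ}
    (hh : ContinuousOn h (Ici 0)) (k : ℕ) :
    ContinuousOn (fun x => (-ω) ^ k * rl (k * δ) h x) (Ici 0) :=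
  continuousOn_const.mul (continuousOn_rl (by positivity) hh)

theorem continuousOn_resolvent {δ : ℝ} (hδ : 0 < δ) (ω : ℝ) {h : ℝ → ℝ}
    (hh : ContinuousOn h (Ici 0)) : ContinuousOn (resolvent δ ω h) (Ici 0) := by
  intro x hx
  obtain ⟨b, hb, hbound⟩ := exists_summable_bound hδ ω hh (x + 1)
  have hc : ContinuousOn (resolvent δ ω h) (Icc 0 (x + 1)) :=
    continuousOn_tsum (fun k => (continuousOn_pow_mul_rl hδ.le ω hh k).mono Icc_subset_Ici_self)
      hb hbound
  refine (hc x ⟨hx, by linarith⟩).mono_of_mem_nhdsWithin ?_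
  rw [← Ici_inter_Iic]
  exact Filter.inter_mem self_mem_nhdsWithin
    (mem_nhdsWithin_of_mem_nhds (Iic_mem_nhds (by linarith)))

theorem hasSum_rl_resolvent {α δ : ℝ} (hα : 0 ≤ α) (hδ : 0 < δ) (ω : ℝ) {h : ℝ → ℝ}
    (hh : ContinuousOn h (Ici 0)) {x : ℝ} (hx : 0 ≤ x) :
    HasSum (fun k : ℕ => (-ω) ^ k * rl (k * δ + α) h x) (rl α (resolvent δ ω h) x) := by
  obtain ⟨b, hb, hbound⟩ := exists_summable_bound hδ ω hh x
  have := hasSum_rl hα hx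
    (fun k => (continuousOn_pow_mul_rl hδ.le ω hh k).mono Icc_subset_Ici_self) hb hbound
  refine this.congr_fun fun k => ?_
  rw [rl_const_mul, rl_rl hα (by positivity) hh hx, add_comm]

/-- Applying `-ω I^δ` shifts the Neumann series by one index, so only the term `k = 0`, which is
`h`, survives. -/
theorem resolvent_eq {δ : ℝ} (hδ : 0 < δ) (ω : ℝ) {h : ℝ → ℝ} (hh : ContinuousOn h (Ici 0))
    {x : ℝ} (hx : 0 ≤ x) :
    resolvent δ ω h x + ω * rl δ (resolvent δ ω h) x = h x := by
  have h0 := hasSum_rl_resolvent le_rfl hδ ω hh hx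
  have h1 := (hasSum_rl_resolvent hδ.le hδ ω hh hx).mul_left (-ω)
  simp only [add_zero, rl_zero] at h0
  have h2 := (hasSum_nat_add_iff' 1).2 h0
  simp only [Finset.sum_range_one, pow_zero, one_mul, Nat.cast_zero, zero_mul, rl_zero] at h2
  have h3 := h2.unique (h1.congr_fun fun k => by push_cast; rw [pow_succ]; ring_nf)
  linarith

/-! ### The Volterra equation -/

/-- Iterating `w = -ω I^δ w` gives `w = (-ω)^k I^{kδ} w` for every `k`, and the right side is
bounded by the terms of a convergent series. -/
theorem eq_zero_of_volterra {δ ω T : ℝ} (hδ : 0 < δ) {w : ℝ → ℝ} (hw : ContinuousOn w (Ici 0))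
    (h : ∀ x ∈ Icc 0 T, w x + ω * rl δ w x = 0) : ∀ x ∈ Icc 0 T, w x = 0 := by
  have iter : ∀ k : ℕ, ∀ x ∈ Icc 0 T, w x = (-ω) ^ k * rl (k * δ) w x := by
    intro k
    induction k with
    | zero => intro x _; simp
    | succ k ih =>
      intro x hx
      have h1 : rl δ w x = (-ω) ^ k * rl ((k + 1 : ℕ) * δ) w x := by
        rw [rl_congr hx.1 fun s hs => ih s ⟨hs.1, hs.2.trans hx.2⟩, rl_const_mul,
          rl_rl hδ.le (by positivity) hw hx.1]
        push_cast; ring_nf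
      have h2 := h x hx
      rw [h1] at h2
      rw [pow_succ]; linarith
  intro x hx
  obtain ⟨b, hb, hbound⟩ := exists_summable_bound hδ ω hw T
  have : |w x| ≤ 0 := ge_of_tendsto hb.tendsto_atTop_zero
    (Filter.Eventually.of_forall fun k => (congrArg abs (iter k x hx)).le.trans (hbound k x hx))
  exact abs_nonpos_iff.1 this

/-- `I^μ` applied to the resolvent equation, since `I^μ` and `I^δ` commute. -/
theorem rl_resolvent_eq {μ δ : ℝ} (hμ : 0 ≤ μ) (hδ : 0 < δ) (ω : ℝ) {h : ℝ → ℝ}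
    (hh : ContinuousOn h (Ici 0)) {x : ℝ} (hx : 0 ≤ x) :
    rl μ (resolvent δ ω h) x + ω * rl δ (rl μ (resolvent δ ω h)) x = rl μ h x := by
  have hv := continuousOn_resolvent hδ ω hh
  have hm : ∀ {f : ℝ → ℝ}, ContinuousOn f (Ici 0) → ContinuousOn f (Icc 0 x) :=
    fun hf => hf.mono Icc_subset_Ici_self
  rw [rl_congr (f := h) hx fun s hs => (resolvent_eq hδ ω hh hs.1).symm, rl_add (g := fun s => ω * rl δ (resolvent δ ω h) s) hμ hx
    (hm hv)    (hm (continuousOn_const.mul (continuousOn_rl hδ.le hv))), rl_const_mul,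
    rl_rl hμ hδ.le hv hx, rl_rl hδ.le hμ hv hx, add_comm δ]

theorem volterra_unique {μ δ ω T : ℝ} (hμ : 0 ≤ μ) (hδ : 0 < δ) {h u : ℝ → ℝ}
    (hh : ContinuousOn h (Ici 0)) (hu : ContinuousOn u (Ici 0))
    (heq : ∀ x ∈ Icc 0 T, u x + ω * rl δ u x = rl μ h x) :
    ∀ x ∈ Icc 0 T, u x = rl μ (resolvent δ ω h) x := by
  have hv := continuousOn_rl hμ (continuousOn_resolvent hδ ω hh)
  have hv' : ContinuousOn (fun x => (-1) * rl μ (resolvent δ ω h) x) (Ici 0) :=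
    continuousOn_const.mul hv
  intro x hx
  have := eq_zero_of_volterra (w := fun x => u x + (-1) * rl μ (resolvent δ ω h) x) hδ
    (hu.add hv') (ω := ω) (T := T) (fun y hy => ?_) x hx
  · linarith
  · rw [rl_add hδ.le hy.1 (hu.mono Icc_subset_Ici_self) (hv'.mono Icc_subset_Ici_self),
      rl_const_mul]
    linarith [heq y hy, rl_resolvent_eq hμ hδ ω hh hy.1]

/-! ### The Mittag-Leffler kernel -/

theorem continuous_mittagLeffler {p q : ℝ} (hp : 0 < p) (hq : 0 < q) :
    Continuous (mittagLeffler p q) := by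
  refine continuous_iff_continuousAt.2 fun x => ?_
  have hc : ContinuousOn (mittagLeffler p q) (Metric.ball 0 (|x| + 1)) := by
    refine continuousOn_tsum (fun k => by fun_prop)
      (summable_mittagLeffler hp hq (|x| + 1)) fun k y hy => ?_
    have hG : 0 < Real.Gamma (p * k + q) := Real.Gamma_pos_of_pos (by positivity)
    rw [mem_ball_zero_iff] at hy
    rw [norm_div, norm_pow, Real.norm_of_nonneg hG.le]
    gcongr
  exact hc.continuousAt (Metric.isOpen_ball.mem_nhds (by simp))

theorem intervalIntegrable_mittagLeffler {μ δ : ℝ} (hμ : 0 < μ) (hδ : 0 < δ) (ω : ℝ) {h : ℝ → ℝ}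
    (hh : ContinuousOn h (Ici 0)) {x : ℝ} (hx : 0 ≤ x) :
    IntervalIntegrable (fun s => (x - s) ^ (μ - 1) * mittagLeffler δ μ (-ω * (x - s) ^ δ) * h s)
      volume 0 x := by
  have hc : Continuous fun s : ℝ => mittagLeffler δ μ (-ω * (x - s) ^ δ) :=
    (continuous_mittagLeffler hδ hμ).comp
      (continuous_const.mul ((Real.continuous_rpow_const hδ.le).comp (by fun_prop)))
  exact ((intervalIntegrable_kernel hμ x).mul_continuousOn hc.continuousOn).mul_continuousOn
    (hh.mono (by rw [uIcc_of_le hx]; exact Icc_subset_Ici_self))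

/-- Expanded termwise, the `k`-th summand of the kernel is `(-ω)^k` times the kernel of `I^{kδ+μ}`.
-/
theorem integral_mittagLeffler_eq_rl_resolvent {μ δ : ℝ} (hμ : 0 < μ) (hδ : 0 < δ) (ω : ℝ)
    {h : ℝ → ℝ} (hh : ContinuousOn h (Ici 0)) {x : ℝ} (hx : 0 ≤ x) :
    ∫ s in (0 : ℝ)..x, (x - s) ^ (μ - 1) * mittagLeffler δ μ (-ω * (x - s) ^ δ) * h s
      = rl μ (resolvent δ ω h) x := by
  obtain ⟨M, hM⟩ := exists_abs_le hh x
  have hM0 : 0 ≤ M := (abs_nonneg _).trans (hM 0 ⟨le_rfl, hx⟩)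
  have hG : ∀ k : ℕ, 0 < Real.Gamma (δ * k + μ) := fun k =>
    Real.Gamma_pos_of_pos (by positivity)
  have hs := hasSum_integral_mul_of_bound hx (intervalIntegrable_kernel hμ x)
    (f := fun k s => (-ω * (x - s) ^ δ) ^ k / Real.Gamma (δ * k + μ) * h s)
    (b := fun k => (|ω| * x ^ δ) ^ k / Real.Gamma (δ * k + μ) * M) (fun k => ?_)
    ((summable_mittagLeffler hδ hμ _).mul_right M) (fun k s hs => ?_)
  · have e : ∀ s, (x - s) ^ (μ - 1) * mittagLeffler δ μ (-ω * (x - s) ^ δ) * h s =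
        (x - s) ^ (μ - 1) * ∑' k : ℕ, (-ω * (x - s) ^ δ) ^ k / Real.Gamma (δ * k + μ) * h s := by
      intro s
      rw [tsum_mul_right, mittagLeffler, mul_assoc]
    simp_rw [e]
    refine hs.unique ((hasSum_rl_resolvent hμ.le hδ ω hh hx).congr_fun fun k => ?_)
    rw [rl_of_pos (by positivity), ← intervalIntegral.integral_const_mul]
    refine intervalIntegral.integral_congr_ae ?_
    -- Adding exponents needs a positive base, so the null set `s = x` is discarded.
    filter_upwards [compl_mem_ae_iff.2 (measure_singleton x)] with s hsx hs
    rw [uIoc_of_le hx] at hs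
    have h0 : 0 < x - s := sub_pos.2 (lt_of_le_of_ne hs.2 hsx)
    have h1 : (x - s) ^ ((k : ℝ) * δ + μ - 1) = ((x - s) ^ δ) ^ k * (x - s) ^ (μ - 1) := by
      rw [← Real.rpow_natCast, ← Real.rpow_mul h0.le, ← Real.rpow_add h0]
      congr 1; ring
    rw [h1, mul_pow, mul_comm (k : ℝ) δ]
    ring
  · have : Continuous fun s : ℝ => (x - s) ^ δ :=
      (Real.continuous_rpow_const hδ.le).comp (by fun_prop)
    exact (Continuous.continuousOn (by fun_prop)).mul (hh.mono Icc_subset_Ici_self)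
  · have h1 : |(x - s) ^ δ| ≤ x ^ δ := by
      rw [abs_of_nonneg (Real.rpow_nonneg (sub_nonneg.2 hs.2) _)]
      exact Real.rpow_le_rpow (sub_nonneg.2 hs.2) (by linarith [hs.1]) hδ.le
    have := hG k
    rw [abs_mul, abs_div, abs_pow, abs_mul, abs_neg, abs_of_pos this]
    have := hM s hs
    gcongr

/-! ### Reduction of the integrated equations to Volterra form -/

/-- `I^μ` turns the hypothesis into `I^1 (u + ω I^{μ-κ} u) = I^1 I^μ h`, from which `I^1` can be
cancelled. -/
theorem eq_rl_resolvent_of_rl_eq {μ κ ω T : ℝ} (hκ : 0 < κ) (hκμ : κ < μ) (hμ : μ ≤ 1)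
    (hT : 0 < T) {h u : ℝ → ℝ} (hh : ContinuousOn h (Ici 0)) (hu : ContinuousOn u (Ici 0))
    (heq : ∀ x ∈ Icc 0 T, rl (1 - μ) u x + ω * rl (1 - κ) u x = rl 1 h x) :
    ∀ x ∈ Icc 0 T, u x = rl μ (resolvent (μ - κ) ω h) x := by
  have hμ0 : 0 < μ := hκ.trans hκμ
  have hδ : 0 < μ - κ := sub_pos.2 hκμ
  have hc : ContinuousOn (fun y => ω * rl (μ - κ) u y) (Ici 0) :=
    continuousOn_const.mul (continuousOn_rl hδ.le hu)
  refine volterra_unique hμ0.le hδ hh hu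
    (rl_one_cancel (f := fun y => u y + ω * rl (μ - κ) u y) (hu.add hc)
      (continuousOn_rl hμ0.le hh) hT fun x hx => ?_)
  have hm : ∀ {f : ℝ → ℝ}, ContinuousOn f (Ici 0) → ContinuousOn f (Icc 0 x) :=
    fun hf => hf.mono Icc_subset_Ici_self
  have h1 : rl μ (fun y => rl (1 - μ) u y + ω * rl (1 - κ) u y) x = rl μ (rl 1 h) x :=
    rl_congr hx.1 fun s hs => heq s ⟨hs.1, hs.2.trans hx.2⟩
  rw [rl_add (g := fun y => ω * rl (1 - κ) u y) hμ0.le hx.1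
    (hm (continuousOn_rl (by linarith) hu))
    (hm (continuousOn_const.mul (continuousOn_rl (by linarith) hu))), rl_const_mul,
    rl_rl hμ0.le (by linarith) hu hx.1, rl_rl hμ0.le (by linarith) hu hx.1,
    rl_rl hμ0.le zero_le_one hh hx.1] at h1
  rw [rl_add (g := fun y => ω * rl (μ - κ) u y) zero_le_one hx.1 (hm hu) (hm hc), rl_const_mul,
    rl_rl zero_le_one hδ.le hu hx.1, rl_rl zero_le_one hμ0.le hh hx.1, add_comm 1 μ, ← h1]
  ring_nf

/-- Used with `g = z' / Φ'` in the new variable, where `I^1 g = z - z(a)`. Here `I^μ` yields the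
Volterra equation for `I^1 g` directly. -/
theorem rl_one_eq_rl_resolvent_of_rl_eq {μ κ ω T : ℝ} (hκ : 0 < κ) (hκμ : κ < μ) (hμ : μ ≤ 1)
    {h g : ℝ → ℝ} (hh : ContinuousOn h (Ici 0)) (hg : ContinuousOn g (Ici 0))
    (heq : ∀ x ∈ Icc 0 T, rl (1 - μ) g x + ω * rl (1 - κ) g x = h x) :
    ∀ x ∈ Icc 0 T, rl 1 g x = rl μ (resolvent (μ - κ) ω h) x := by
  have hμ0 : 0 < μ := hκ.trans hκμ
  have hδ : 0 < μ - κ := sub_pos.2 hκμ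
  refine volterra_unique hμ0.le hδ hh (continuousOn_rl zero_le_one hg) fun x hx => ?_
  have hm : ∀ {f : ℝ → ℝ}, ContinuousOn f (Ici 0) → ContinuousOn f (Icc 0 x) :=
    fun hf => hf.mono Icc_subset_Ici_self
  rw [← rl_congr hx.1 fun s hs => heq s ⟨hs.1, hs.2.trans hx.2⟩,
    rl_add (g := fun y => ω * rl (1 - κ) g y) hμ0.le hx.1
    (hm (continuousOn_rl (by linarith) hg))
    (hm (continuousOn_const.mul (continuousOn_rl (by linarith) hg))), rl_const_mul,
    rl_rl hμ0.le (by linarith) hg hx.1, rl_rl hμ0.le (by linarith) hg hx.1,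
    rl_rl hδ.le zero_le_one hg hx.1]
  ring_nf

/-! ### The time change -/

/-- A time change `Φ` of `[a, b]` with the properties assumed in the theorem, together with a
continuous function `Ψ` on `ℝ` that inverts `Φ - Φ a`. -/
structure IsTimeChange (a b : ℝ) (Φ Ψ : ℝ → ℝ) : Prop where
  lt : a < b
  strictMonoOn : StrictMonoOn Φ (Icc a b)
  differentiableOn : DifferentiableOn ℝ Φ (Icc a b)
  derivWithin_ne_zero : ∀ l ∈ Icc a b, derivWithin Φ (Icc a b) l ≠ 0
  continuous_inv : Continuous Ψ
  inv_mem : ∀ s, Ψ s ∈ Icc a b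
  inv_apply : ∀ l ∈ Icc a b, Ψ (Φ l - Φ a) = l

/-- Projecting `Φ a + s` onto `[Φ a, Φ b]` before inverting defines the inverse on all of `ℝ`; it is
monotone and onto `[a, b]`, hence continuous. Composition with it then makes data on `[a, b]`
continuous on the whole half-line. -/
theorem exists_isTimeChange {a b : ℝ} (hab : a < b) {Φ : ℝ → ℝ}
    (hmono : StrictMonoOn Φ (Icc a b)) (hdiff : DifferentiableOn ℝ Φ (Icc a b))
    (hne : ∀ l ∈ Icc a b, derivWithin Φ (Icc a b) l ≠ 0) :
    ∃ Ψ : ℝ → ℝ, IsTimeChange a b Φ Ψ := by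
  have hΦab : Φ a ≤ Φ b := hmono.monotoneOn ⟨le_rfl, hab.le⟩ ⟨hab.le, le_rfl⟩ hab.le
  have hsurj : SurjOn Φ (Icc a b) (Icc (Φ a) (Φ b)) :=
    intermediate_value_Icc hab.le hdiff.continuousOn
  have hex : ∀ s : ℝ, ∃ l : Icc a b, Φ l = projIcc (Φ a) (Φ b) hΦab (Φ a + s) := fun s => by
    obtain ⟨l, hl, h⟩ := hsurj (projIcc (Φ a) (Φ b) hΦab (Φ a + s)).2
    exact ⟨⟨l, hl⟩, h⟩
  choose ψ hψ using hex
  have hinv : ∀ l : Icc a b, ψ (Φ l - Φ a) = l := by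
    intro l
    refine Subtype.ext (hmono.injOn (ψ _).2 l.2 ?_)
    have hm : Φ l ∈ Icc (Φ a) (Φ b) := ⟨hmono.monotoneOn ⟨le_rfl, hab.le⟩ l.2 l.2.1,
      hmono.monotoneOn l.2 ⟨hab.le, le_rfl⟩ l.2.2⟩
    rw [hψ, add_sub_cancel, projIcc_of_mem hΦab hm]
  have hψmono : Monotone ψ := by
    intro s t hst
    rw [← Subtype.coe_le_coe, ← hmono.le_iff_le (ψ s).2 (ψ t).2, hψ, hψ, Subtype.coe_le_coe]
    exact monotone_projIcc hΦab (by linarith)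
  exact ⟨fun s => ψ s, hab, hmono, hdiff, hne, continuous_subtype_val.comp
    (hψmono.continuous_of_surjective fun l => ⟨_, hinv l⟩), fun s => (ψ s).2,
    fun l hl => congrArg Subtype.val (hinv ⟨l, hl⟩)⟩

namespace IsTimeChange

variable {a b : ℝ} {Φ Ψ : ℝ → ℝ} (hΦ : IsTimeChange a b Φ Ψ)

include hΦ

theorem left_mem : a ∈ Icc a b := ⟨le_rfl, hΦ.lt.le⟩

theorem sub_mem {r l : ℝ} (hl : l ∈ Icc a b) (hr : r ∈ Icc a l) :
    Φ r - Φ a ∈ Icc 0 (Φ l - Φ a) := by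
  have hr' : r ∈ Icc a b := ⟨hr.1, hr.2.trans hl.2⟩
  exact ⟨sub_nonneg.2 (hΦ.strictMonoOn.monotoneOn hΦ.left_mem hr' hr.1),
    sub_le_sub_right (hΦ.strictMonoOn.monotoneOn hr' hl hr.2) _⟩

theorem sub_nonneg {l : ℝ} (hl : l ∈ Icc a b) : 0 ≤ Φ l - Φ a :=
  (hΦ.sub_mem hl ⟨hl.1, le_rfl⟩).1

theorem image_eq {l : ℝ} (hl : l ∈ Icc a b) :
    (fun r => Φ r - Φ a) '' Icc a l = Icc 0 (Φ l - Φ a) := by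
  refine Subset.antisymm (image_subset_iff.2 fun r hr => hΦ.sub_mem hl hr) ?_
  have := intermediate_value_Icc (f := fun r => Φ r - Φ a) hl.1
    ((hΦ.differentiableOn.continuousOn.mono (Icc_subset_Icc_right hl.2)).sub continuousOn_const)
  simpa using this

theorem exists_eq_of_mem {l s : ℝ} (hl : l ∈ Icc a b) (hs : s ∈ Icc 0 (Φ l - Φ a)) :
    ∃ r ∈ Icc a l, Φ r - Φ a = s := by
  rw [← hΦ.image_eq hl] at hs; exact hs

theorem hasDerivWithinAt {l : ℝ} (hl : l ∈ Icc a b) :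
    HasDerivWithinAt (fun r => Φ r - Φ a) (derivWithin Φ (Icc a b) l) (Icc a b) l :=
  (hΦ.differentiableOn l hl).hasDerivWithinAt.sub_const _

/-- The change of variables for injective differentiable maps requires neither continuity of `Φ'`
nor regularity of `G`; monotonicity removes the absolute value of `Φ'`. -/
theorem integral_comp {l : ℝ} (hl : l ∈ Icc a b) (G : ℝ → ℝ) :
    ∫ r in a..l, derivWithin Φ (Icc a b) r * G (Φ r - Φ a)
      = ∫ s in (0 : ℝ)..(Φ l - Φ a), G s := by
  have hsub : Icc a l ⊆ Icc a b := Icc_subset_Icc_right hl.2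
  have hinj : InjOn (fun r => Φ r - Φ a) (Icc a l) := fun r hr s hs h =>
    hΦ.strictMonoOn.injOn (hsub hr) (hsub hs) (sub_left_injective h)
  have := integral_image_eq_integral_abs_deriv_smul measurableSet_Icc
    (fun r hr => (hΦ.hasDerivWithinAt (hsub hr)).mono hsub) hinj G
  rw [hΦ.image_eq hl] at this
  rw [intervalIntegral.integral_of_le hl.1, intervalIntegral.integral_of_le (hΦ.sub_nonneg hl),
    ← integral_Icc_eq_integral_Ioc, ← integral_Icc_eq_integral_Ioc, this]
  simp only [smul_eq_mul, abs_of_nonneg hΦ.strictMonoOn.monotoneOn.derivWithin_nonneg]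

theorem intervalIntegrable_comp {l : ℝ} (hl : l ∈ Icc a b) {G : ℝ → ℝ}
    (hG : IntervalIntegrable G volume 0 (Φ l - Φ a)) :
    IntervalIntegrable (fun r => derivWithin Φ (Icc a b) r * G (Φ r - Φ a)) volume a l := by
  have hsub : Icc a l ⊆ Icc a b := Icc_subset_Icc_right hl.2
  have hinj : InjOn (fun r => Φ r - Φ a) (Icc a l) := fun r hr s hs h =>
    hΦ.strictMonoOn.injOn (hsub hr) (hsub hs) (sub_left_injective h)
  have := integrableOn_image_iff_integrableOn_abs_deriv_smul measurableSet_Icc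
    (fun r hr => (hΦ.hasDerivWithinAt (hsub hr)).mono hsub) hinj G
  rw [hΦ.image_eq hl] at this
  rw [intervalIntegrable_iff_integrableOn_Icc_of_le (hΦ.sub_nonneg hl), this] at hG
  rw [intervalIntegrable_iff_integrableOn_Icc_of_le hl.1]
  simpa only [smul_eq_mul, abs_of_nonneg hΦ.strictMonoOn.monotoneOn.derivWithin_nonneg] using hG

theorem phiIntegral_eq_rl {α : ℝ} (hα : 0 < α) (z : ℝ → ℝ) {l : ℝ} (hl : l ∈ Icc a b) :
    phiIntegral a b Φ α z l = rl α (fun s => z (Ψ s)) (Φ l - Φ a) := by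
  rw [rl_of_pos hα, ← hΦ.integral_comp hl, phiIntegral]
  refine intervalIntegral.integral_congr fun r hr => ?_
  rw [uIcc_of_le hl.1] at hr
  simp only [hΦ.inv_apply r ⟨hr.1, hr.2.trans hl.2⟩, sub_sub_sub_cancel_right]
  ring

theorem caputoPrimitive_eq_rl {ν : ℝ} (hν : ν ≤ 1) (z : ℝ → ℝ) {l : ℝ} (hl : l ∈ Icc a b) :
    caputoPrimitive a b Φ ν z l = rl (1 - ν) (fun s => z (Ψ s) - z a) (Φ l - Φ a) := by
  rw [caputoPrimitive]
  split_ifs with h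
  · simp [h, hΦ.inv_apply l hl]
  · exact hΦ.phiIntegral_eq_rl (sub_pos.2 (lt_of_le_of_ne hν h)) _ hl

theorem caputoC1_eq_rl {ν : ℝ} (hν : ν ≤ 1) (z : ℝ → ℝ) {l : ℝ} (hl : l ∈ Icc a b) :
    caputoC1 a b Φ ν z l = rl (1 - ν)
      (fun s => derivWithin z (Icc a b) (Ψ s) / derivWithin Φ (Icc a b) (Ψ s)) (Φ l - Φ a) := by
  rw [caputoC1]
  split_ifs with h
  · simp [h, hΦ.inv_apply l hl]
  · exact hΦ.phiIntegral_eq_rl (sub_pos.2 (lt_of_le_of_ne hν h)) _ hl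

theorem hasDerivWithinAt_rl_one_comp {f : ℝ → ℝ} (hf : ContinuousOn f (Ici 0)) {l : ℝ}
    (hl : l ∈ Icc a b) :
    HasDerivWithinAt (fun r => rl 1 f (Φ r - Φ a))
      (f (Φ l - Φ a) * derivWithin Φ (Icc a b) l) (Icc a b) l :=
  HasDerivWithinAt.comp (h₂ := rl 1 f) (h := fun r => Φ r - Φ a) l
    (hasDerivWithinAt_rl_one hf (hΦ.sub_nonneg hl)) (hΦ.hasDerivWithinAt hl)
    fun _ hr => hΦ.sub_nonneg hr

theorem continuousOn_comp_inv {f : ℝ → ℝ} (hf : ContinuousOn f (Icc a b)) (s : Set ℝ) :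
    ContinuousOn (fun x => f (Ψ x)) s :=
  (hf.comp_continuous hΦ.continuous_inv hΦ.inv_mem).continuousOn

theorem solutionIntegrand_eqOn {μ κ ω : ℝ} (H : ℝ → ℝ) {l : ℝ} (hl : l ∈ Icc a b) :
    EqOn (solutionIntegrand a b Φ μ κ ω H l) (fun r => derivWithin Φ (Icc a b) r *
      (fun s => (Φ l - Φ a - s) ^ (μ - 1)
        * mittagLeffler (μ - κ) μ (-ω * (Φ l - Φ a - s) ^ (μ - κ)) * H (Ψ s)) (Φ r - Φ a))
      (uIcc a l) := by
  intro r hr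
  rw [uIcc_of_le hl.1] at hr
  simp only [solutionIntegrand, hΦ.inv_apply r ⟨hr.1, hr.2.trans hl.2⟩, sub_sub_sub_cancel_right]
  ring

/-! ### Existence and uniqueness on the original interval -/

variable {μ κ ω : ℝ} (hκ : 0 < κ) (hκμ : κ < μ) (hμ : μ ≤ 1) {H : ℝ → ℝ}
  (hH : ContinuousOn H (Icc a b))

include hκ hκμ hH

theorem intervalIntegrable_solutionIntegrand {l : ℝ} (hl : l ∈ Icc a b) :
    IntervalIntegrable (solutionIntegrand a b Φ μ κ ω H l) volume a l := by
  refine (hΦ.intervalIntegrable_comp hl (intervalIntegrable_mittagLeffler (hκ.trans hκμ)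
    (sub_pos.2 hκμ) ω (hΦ.continuousOn_comp_inv hH _) (hΦ.sub_nonneg hl))).congr fun r hr => ?_
  exact (hΦ.solutionIntegrand_eqOn H hl (uIoc_subset_uIcc hr)).symm

theorem integral_solutionIntegrand {l : ℝ} (hl : l ∈ Icc a b) :
    ∫ r in a..l, solutionIntegrand a b Φ μ κ ω H l r
      = rl μ (resolvent (μ - κ) ω fun s => H (Ψ s)) (Φ l - Φ a) := by
  rw [← integral_mittagLeffler_eq_rl_resolvent (hκ.trans hκμ) (sub_pos.2 hκμ) ω
    (hΦ.continuousOn_comp_inv hH _) (hΦ.sub_nonneg hl), ← hΦ.integral_comp hl]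
  exact intervalIntegral.integral_congr (hΦ.solutionIntegrand_eqOn H hl)

include hμ

theorem isSolution (za : ℝ) : IsSolution a b Φ μ κ ω H za
    (fun l => za + ∫ r in a..l, solutionIntegrand a b Φ μ κ ω H l r) := by
  have hμ0 : 0 < μ := hκ.trans hκμ
  have hδ : 0 < μ - κ := sub_pos.2 hκμ
  have hh : ContinuousOn (fun s => H (Ψ s)) (Ici 0) := hΦ.continuousOn_comp_inv hH _
  set z : ℝ → ℝ := fun l => za + ∫ r in a..l, solutionIntegrand a b Φ μ κ ω H l r with hz
  set v := resolvent (μ - κ) ω fun s => H (Ψ s) with hv_def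
  have hv : ContinuousOn v (Ici 0) := continuousOn_resolvent hδ ω hh
  have hza : z a = za := by simp [hz]
  have hzl : ∀ l ∈ Icc a b, z l = za + rl μ v (Φ l - Φ a) := fun l hl => by
    rw [hz]; simp only [hΦ.integral_solutionIntegrand hκ hκμ hH hl, hv_def]
  -- `I^{1-ν} I^μ v = I^1 I^{μ-ν} v` exhibits the primitive as an integral of a continuous function,
  -- so it is differentiable.
  have hprim : ∀ ν : ℝ, ν ≤ μ → ∀ l ∈ Icc a b,
      caputoPrimitive a b Φ ν z l = rl 1 (rl (μ - ν) v) (Φ l - Φ a) := by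
    intro ν hν l hl
    have hx := hΦ.sub_nonneg hl
    rw [hΦ.caputoPrimitive_eq_rl (hν.trans hμ) z hl, rl_congr (g := rl μ v) hx fun s hs => ?_,
      rl_rl (by linarith) hμ0.le hv hx, rl_rl zero_le_one (by linarith) hv hx]
    · ring_nf
    · obtain ⟨r, hr, rfl⟩ := hΦ.exists_eq_of_mem hl hs
      have hr' : r ∈ Icc a b := ⟨hr.1, hr.2.trans hl.2⟩
      rw [hΦ.inv_apply r hr', hza, hzl r hr', add_sub_cancel_left]
  have hderiv : ∀ ν : ℝ, ν ≤ μ → ∀ l ∈ Icc a b,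
      HasDerivWithinAt (caputoPrimitive a b Φ ν z)
        (rl (μ - ν) v (Φ l - Φ a) * derivWithin Φ (Icc a b) l) (Icc a b) l := fun ν hν l hl =>
    (hΦ.hasDerivWithinAt_rl_one_comp (continuousOn_rl (by linarith) hv) hl).congr
      (hprim ν hν) (hprim ν hν l hl)
  have hcaputo : ∀ ν : ℝ, ν ≤ μ → ∀ l ∈ Icc a b,
      caputo a b Φ ν z l = rl (μ - ν) v (Φ l - Φ a) := fun ν hν l hl => by
    rw [caputo, (hderiv ν hν l hl).derivWithin (uniqueDiffOn_Icc hΦ.lt l hl),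
      mul_div_cancel_right₀ _ (hΦ.derivWithin_ne_zero l hl)]
  refine ⟨?_, fun l hl => (hderiv μ le_rfl l hl).differentiableWithinAt,
    fun l hl => (hderiv κ hκμ.le l hl).differentiableWithinAt, fun l hl => ?_, hza⟩
  · refine ContinuousOn.congr (continuousOn_const.add ((continuousOn_rl hμ0.le hv).comp
      (hΦ.differentiableOn.continuousOn.sub continuousOn_const)
      fun l hl => hΦ.sub_nonneg hl)) hzl
  · rw [hcaputo μ le_rfl l hl, hcaputo κ hκμ.le l hl, sub_self, rl_zero,
      resolvent_eq hδ ω hh (hΦ.sub_nonneg hl), hΦ.inv_apply l hl]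

theorem eq_of_isSolution {za : ℝ} {z : ℝ → ℝ} (hz : IsSolution a b Φ μ κ ω H za z) {l : ℝ}
    (hl : l ∈ Icc a b) :
    z l = za + ∫ r in a..l, solutionIntegrand a b Φ μ κ ω H l r := by
  have hb : b ∈ Icc a b := ⟨hΦ.lt.le, le_rfl⟩
  have hT : 0 < Φ b - Φ a := sub_pos.2 (hΦ.strictMonoOn hΦ.left_mem hb hΦ.lt)
  have hh : ContinuousOn (fun s => H (Ψ s)) (Ici 0) := hΦ.continuousOn_comp_inv hH _
  have hu : ContinuousOn (fun s => z (Ψ s) - z a) (Ici 0) :=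
    (hΦ.continuousOn_comp_inv hz.continuousOn _).sub continuousOn_const
  have hu0 : z (Ψ 0) - z a = 0 := by
    have := hΦ.inv_apply a hΦ.left_mem
    rw [sub_self] at this
    rw [this, sub_self]
  -- For `ν = 1` the primitive is `z - z(a)` itself; otherwise it is an integral over a degenerate
  -- interval.
  have hprim0 : ∀ ν : ℝ, ν ≤ 1 → caputoPrimitive a b Φ ν z a = 0 := fun ν hν => by
    rw [hΦ.caputoPrimitive_eq_rl hν z hΦ.left_mem, sub_self]
    rcases hν.eq_or_lt with rfl | hν
    · rw [sub_self, rl_zero, hu0]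
    · exact rl_apply_zero (sub_pos.2 hν) _
  -- Multiplied by `Φ'`, the equation equates the derivatives of two functions that both vanish at
  -- `a`, so these functions agree. This is the integrated equation.
  have hP : ∀ r ∈ Icc a b, HasDerivWithinAt
      (fun r => caputoPrimitive a b Φ μ z r + ω * caputoPrimitive a b Φ κ z r)
      (H r * derivWithin Φ (Icc a b) r) (Icc a b) r := fun r hr => by
    have h1 := (hz.differentiable_mu r hr).hasDerivWithinAt
    have h2 := (hz.differentiable_kappa r hr).hasDerivWithinAt.const_mul ω
    refine (h1.add h2).congr_deriv ?_
    have hne := hΦ.derivWithin_ne_zero r hr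
    rw [← hz.equation r hr, caputo, caputo]
    field_simp
  have hQ : ∀ r ∈ Icc a b, HasDerivWithinAt (fun r => rl 1 (fun s => H (Ψ s)) (Φ r - Φ a))
      (H r * derivWithin Φ (Icc a b) r) (Icc a b) r := fun r hr => by
    have := hΦ.hasDerivWithinAt_rl_one_comp hh hr
    rwa [hΦ.inv_apply r hr] at this
  have hPQ := eq_of_derivWithin_eq (fun r hr => (hP r hr).differentiableWithinAt)
    (fun r hr => (hQ r hr).differentiableWithinAt)
    (fun r hr => by
      have hr' := Ico_subset_Icc_self hr
      have hU := uniqueDiffOn_Icc hΦ.lt r hr'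
      rw [(hP r hr').derivWithin hU, (hQ r hr').derivWithin hU])
    (by simp [hprim0 μ hμ, hprim0 κ (hκμ.le.trans hμ), rl_apply_zero one_pos])
  have := eq_rl_resolvent_of_rl_eq hκ hκμ hμ hT hh hu (ω := ω) (fun x hx => by
    obtain ⟨r, hr, rfl⟩ := hΦ.exists_eq_of_mem hb hx
    rw [← hΦ.caputoPrimitive_eq_rl hμ z hr, ← hΦ.caputoPrimitive_eq_rl (hκμ.le.trans hμ) z hr]
    exact hPQ r hr) (Φ l - Φ a) (hΦ.sub_mem hb hl)
  rw [hΦ.integral_solutionIntegrand hκ hκμ hH hl, ← this, hΦ.inv_apply l hl, hz.initial]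
  ring

theorem eq_of_isC1Solution (hC1 : ContDiffOn ℝ 1 Φ (Icc a b)) {za : ℝ} {z : ℝ → ℝ}
    (hz : IsC1Solution a b Φ μ κ ω H za z) {l : ℝ} (hl : l ∈ Icc a b) :
    z l = za + ∫ r in a..l, solutionIntegrand a b Φ μ κ ω H l r := by
  have hb : b ∈ Icc a b := ⟨hΦ.lt.le, le_rfl⟩
  have hU := uniqueDiffOn_Icc hΦ.lt
  have hh : ContinuousOn (fun s => H (Ψ s)) (Ici 0) := hΦ.continuousOn_comp_inv hH _
  -- Continuity of `Φ'` enters here: it makes `z' / Φ'` continuous.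
  have hg := hΦ.continuousOn_comp_inv ((hz.contDiffOn.continuousOn_derivWithin hU le_rfl).div
    (hC1.continuousOn_derivWithin hU le_rfl) hΦ.derivWithin_ne_zero) (Ici 0)
  have hzd : DifferentiableOn ℝ z (Icc a b) := hz.contDiffOn.differentiableOn one_ne_zero
  have hQ := fun r (hr : r ∈ Icc a b) => hΦ.hasDerivWithinAt_rl_one_comp hg hr
  have hzQ := eq_of_derivWithin_eq (hzd.sub_const (z a))
    (fun r hr => (hQ r hr).differentiableWithinAt)
    (fun r hr => by
      have hr' := Ico_subset_Icc_self hr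
      rw [(hQ r hr').derivWithin (hU r hr'), derivWithin_sub_const, hΦ.inv_apply r hr',
        Pi.div_apply, div_mul_cancel₀ _ (hΦ.derivWithin_ne_zero r hr')])
    (by simp [rl_apply_zero one_pos]) l hl
  have := rl_one_eq_rl_resolvent_of_rl_eq hκ hκμ hμ hh hg (ω := ω) (T := Φ b - Φ a)
    (fun x hx => by
      obtain ⟨r, hr, rfl⟩ := hΦ.exists_eq_of_mem hb hx
      have he := hz.equation r hr
      rw [hΦ.caputoC1_eq_rl hμ z hr, hΦ.caputoC1_eq_rl (hκμ.le.trans hμ) z hr] at he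
      rw [hΦ.inv_apply r hr]
      exact he) (Φ l - Φ a) (hΦ.sub_mem hb hl)
  rw [hΦ.integral_solutionIntegrand hκ hκμ hH hl, ← this, ← hzQ, hz.initial]
  ring

end IsTimeChange

end PhiCaputo

end

theorem mainTheorem1 (a b : ℝ) (hab : a < b) (Φ : ℝ → ℝ)
    (hΦ_mono : StrictMonoOn Φ (Set.Icc a b))
    (hΦ_diff : DifferentiableOn ℝ Φ (Set.Icc a b))
    (hΦ_ne : ∀ l ∈ Set.Icc a b, derivWithin Φ (Set.Icc a b) l ≠ 0)
    (μ κ ω : ℝ) (hκ : 0 < κ) (hκμ : κ < μ) (hμ : μ ≤ 1) (hω : 0 < ω)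
    (H : ℝ → ℝ) (hH : ContinuousOn H (Set.Icc a b)) (za : ℝ) :
    (∀ l ∈ Set.Icc a b, IntervalIntegrable
      (PhiCaputo.solutionIntegrand a b Φ μ κ ω H l) MeasureTheory.volume a l) ∧
    PhiCaputo.IsSolution a b Φ μ κ ω H za
      (fun l => za + ∫ r in a..l, PhiCaputo.solutionIntegrand a b Φ μ κ ω H l r) ∧
    (∀ z : ℝ → ℝ, PhiCaputo.IsSolution a b Φ μ κ ω H za z →
      ∀ l ∈ Set.Icc a b,
        z l = za + ∫ r in a..l, PhiCaputo.solutionIntegrand a b Φ μ κ ω H l r) ∧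
    (ContDiffOn ℝ 1 Φ (Set.Icc a b) →
      ∀ z : ℝ → ℝ, PhiCaputo.IsC1Solution a b Φ μ κ ω H za z →
        ∀ l ∈ Set.Icc a b,
          z l = za + ∫ r in a..l, PhiCaputo.solutionIntegrand a b Φ μ κ ω H l r) := by
  obtain ⟨Ψ, hΨ⟩ := PhiCaputo.exists_isTimeChange hab hΦ_mono hΦ_diff hΦ_ne
  exact ⟨fun l hl => hΨ.intervalIntegrable_solutionIntegrand hκ hκμ hH hl,
    hΨ.isSolution hκ hκμ hμ hH za,
    fun z hz l hl => hΨ.eq_of_isSolution hκ hκμ hμ hH hz hl,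
    fun hC1 z hz l hl => hΨ.eq_of_isC1Solution hκ hκμ hμ hH hC1 hz hl⟩
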